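/- Let $\mathbb{T}$ and $\mathbb{T}'$ be free algebraic theories, i.e. signatures $\Sigma_{\mathbb T}$, $\Sigma_{\mathbb T'}$ (sets of operation symbols $\sigma$, each with a set $|\sigma|$ as arity, possibly infinite) without equations, and suppose that $\mathbb{T}$ has no nullary operation symbol. Write $T(V)$ for the set of $\mathbb T$-terms with variables in $V$. *Definitions.* $\mathit{Sub}$ is the category of sets $X$ with a family $\Phi\ni\emptyset,X$ of subsets; a morphism $(X,\Phi)\to(Y,\Psi)$ is a map $f$ with $f^{-1}(U)\in\Phi$ for all $U\in\Psi$. A comodel of a free theory in a category with copowers $B\cdot X$ is an object $S$ with co-operations $S\to|\sigma|\cdot S$, one for each symbol $\sigma$; each term $t\in T(V)$ then has a derived co-operation $S\to V\cdot S$ (evaluation of $t$). The final $\mathbb T$-comodel in sets is $S_{\mathbb T}=\bigl(\prod_{\sigma}|\sigma|\bigr)^{\Sigma_{\mathbb T}^{*}}$ with $s\mapsto(s(\epsilon)_\sigma,\,s(\sigma\,\cdot\,))$. With the sets $[t\mapsto v]=\{s\mid \text{evaluating } t \text{ at } s \text{ returns } v\}$ as sub-basis, it is also the final $\mathbb T$-comodel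 in $\mathit{Sub}$. The set $\mathit{Sub}(S_{\mathbb T},X)$ is a $\mathbb T$-model with operations $\sigma\bigl((f_i)_{i\in|\sigma|}\bigr)(s)=f_{s(\epsilon)_\sigma}\bigl(s(\sigma\,\cdot\,)\bigr)$. A $\mathbb T$-$\mathbb T'$-bimodel is a $\mathbb T'$-comodel in the category of $\mathbb T$-models. In that category, $B\cdot X$ can be taken to be the set of those terms in $T(B\times X)$ that have no sub-term of the form $\sigma(\lambda i.(b,x_i))$ with $b\in B$; its operations are those of $T(B\times X)$, except that $\sigma(\lambda i.(b,x_i))$ is replaced by the variable $(b,\sigma(\lambda i.x_i))$. A $\mathbb T$-residual $\mathbb T'$-comodel is a set $R$ with maps $\tau^R:R\to T(|\tau|\times R)$ for $\tau\in\Sigma_{\mathbb T'}$; a map of residual comodels $f:R\to R'$ satisfies $T(|\tau|\times f)\circ\tau^{R}=\tau^{R'}\circ f$. By the inclusions $|\tau|\cdot K\subseteq T(|\tau|\times K)$, every bimodel $K$ is a residual comodel $\check K$. For a residual comodel $R$, the copower $R\cdot S_{\mathbb T}$ in $\mathit{Sub}$ is a $\mathbb T'$-comodel, whose co-operation $\tau$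 at $(r,s)$ evaluates the term $\tau^R(r)$ at $s$; the extent of $R$ is the unique comodel morphism $e:R\cdot S_{\mathbb T}\to S_{\mathbb T'}$ in $\mathit{Sub}$, and its currying is the map $R\to\mathit{Sub}(S_{\mathbb T},S_{\mathbb T'})$, $r\mapsto e(r,-)$. *Theorem.* 1. For each $\tau\in\Sigma_{\mathbb T'}$ the canonical morphism of $\mathbb T$-models $|\tau|\cdot\mathit{Sub}(S_{\mathbb T},S_{\mathbb T'})\to\mathit{Sub}(S_{\mathbb T},|\tau|\cdot S_{\mathbb T'})$ is an isomorphism, and $\mathit{Sub}(S_{\mathbb T},S_{\mathbb T'})$, with the co-operations $$\mathit{Sub}(S_{\mathbb T},S_{\mathbb T'})\longrightarrow\mathit{Sub}(S_{\mathbb T},|\tau|\cdot S_{\mathbb T'})\cong|\tau|\cdot\mathit{Sub}(S_{\mathbb T},S_{\mathbb T'})$$ whose first part is postcomposition with the co-operation $\tau$ of $S_{\mathbb T'}$, is a final $\mathbb T$-$\mathbb T'$-bimodel $E$. 2. There is a final $\mathbb T$-residual $\mathbb T'$-comodel $I$. 3. For every such $I$, let $\mathsf{reify}:\mathit{Sub}(S_{\mathbb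 T},S_{\mathbb T'})\to I$ be the unique map of residual comodels $\check E\to I$, and let $\mathsf{reflect}:I\to\mathit{Sub}(S_{\mathbb T},S_{\mathbb T'})$ be the currying of the extent of $I$. Then $\mathsf{reflect}\circ\mathsf{reify}=\mathrm{id}$, and hence $\mathsf{reflect}$ is surjective. -/

import Mathlib

open CategoryTheory CategoryTheory.Limits

universe u v

namespace FreeTheory

/-! ## Free theories, terms, models -/

/-- A signature: operation symbols, each with a set as its arity. A free algebraic theory is one
without equations, so it is the same thing as its signature. -/
structure Signature where
  Op : Type u
  Arity : Op → Type u

/-- The terms of the free theory `T` with variables in `V`. -/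
inductive Term (T : Signature.{u}) (V : Type u) : Type u where
  | var (v : V) : Term T V
  | op (σ : T.Op) (t : T.Arity σ → Term T V) : Term T V

namespace Term

/-- Substitution. -/
def bind {T : Signature.{u}} {V W : Type u} : Term T V → (V → Term T W) → Term T W
  | var v, f => f v
  | op σ t, f => op σ (fun i => (t i).bind f)

/-- Renaming of variables, the functorial action of `V ↦ T(V)`. -/
def rename {T : Signature.{u}} {V W : Type u} (f : V → W) (t : Term T V) : Term T W :=
  t.bind (fun v => var (f v))

theorem bind_var {T : Signature.{u}} {V : Type u} (t : Term T V) : t.bind var = t := by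
  induction t with
  | var v => rfl
  | op σ t ih => simp only [bind, ih]

theorem bind_bind {T : Signature.{u}} {V W X : Type u} (t : Term T V) (f : V → Term T W)
    (g : W → Term T X) : (t.bind f).bind g = t.bind (fun v => (f v).bind g) := by
  induction t with
  | var v => rfl
  | op σ t ih => simp only [bind, ih]

theorem rename_id {T : Signature.{u}} {V : Type u} (t : Term T V) : t.rename id = t :=
  bind_var t

theorem rename_rename {T : Signature.{u}} {V W X : Type u} (t : Term T V) (f : V → W)
    (g : W → X) : (t.rename f).rename g = t.rename (g ∘ f) :=
  bind_bind t _ _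

end Term

/-- A model of `T` in sets. -/
structure Model (T : Signature.{u}) where
  carrier : Type u
  op : ∀ σ : T.Op, (T.Arity σ → carrier) → carrier

namespace Model

variable {T : Signature.{u}}

/-- Morphisms of models. -/
@[ext]
structure Hom (X Y : Model T) where
  toFun : X.carrier → Y.carrier
  map_op : ∀ (σ : T.Op) (x : T.Arity σ → X.carrier),
    toFun (X.op σ x) = Y.op σ (fun i => toFun (x i))

/-- The category `Mod(T)`. -/
instance : Category.{u} (Model T) where
  Hom := Hom
  id X := ⟨fun x => x, fun _ _ => rfl⟩
  comp f g := ⟨fun x => g.toFun (f.toFun x), fun σ x => by rw [f.map_op, g.map_op]⟩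

@[ext]
theorem hom_ext {X Y : Model T} (f g : X ⟶ Y) (h : ∀ x, f.toFun x = g.toFun x) : f = g :=
  Hom.ext (funext h)

/-- The value in `X` of a term under an assignment of its variables. -/
def interp (X : Model T) {V : Type u} (ρ : V → X.carrier) : Term T V → X.carrier
  | .var v => ρ v
  | .op σ t => X.op σ (fun i => X.interp ρ (t i))

end Model

/-! ## Copowers and comodels -/

/-- A choice of copowers `B · X` in a category. -/
class HasCopowers (C : Type v) [Category.{u} C] where
  copower : Type u → C → C
  inj : ∀ {B : Type u} (X : C), B → (X ⟶ copower B X)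
  desc : ∀ {B : Type u} {X Y : C}, (B → (X ⟶ Y)) → (copower B X ⟶ Y)
  inj_desc : ∀ {B : Type u} {X Y : C} (f : B → (X ⟶ Y)) (b : B), inj X b ≫ desc f = f b
  hom_ext : ∀ {B : Type u} {X Y : C} (g h : copower B X ⟶ Y),
    (∀ b, inj X b ≫ g = inj X b ≫ h) → g = h

section Copowers

open HasCopowers

variable {C : Type v} [Category.{u} C] [HasCopowers C]

/-- The morphism `B · f : B · X ⟶ B · Y`. -/
def copowerMap (B : Type u) {X Y : C} (f : X ⟶ Y) : copower B X ⟶ copower B Y :=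
  desc (fun b => f ≫ inj Y b)

theorem copowerMap_id (B : Type u) (X : C) : copowerMap B (𝟙 X) = 𝟙 (copower B X) := by
  apply hom_ext
  intro b
  simp [copowerMap, inj_desc]

theorem copowerMap_comp (B : Type u) {X Y Z : C} (f : X ⟶ Y) (g : Y ⟶ Z) :
    copowerMap B (f ≫ g) = copowerMap B f ≫ copowerMap B g := by
  apply hom_ext
  intro b
  rw [← Category.assoc]
  simp only [copowerMap, inj_desc, Category.assoc]

theorem desc_comp {B : Type u} {X Y Z : C} (f : B → (X ⟶ Y)) (g : Y ⟶ Z) :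
    desc f ≫ g = desc (fun b => f b ≫ g) := by
  apply hom_ext
  intro b
  rw [← Category.assoc, inj_desc, inj_desc]

end Copowers

/-- A comodel of the free theory `T` in a category with copowers. -/
structure Comodel (T : Signature.{u}) (C : Type v) [Category.{u} C] [HasCopowers C] where
  obj : C
  coop : ∀ σ : T.Op, obj ⟶ HasCopowers.copower (T.Arity σ) obj

namespace Comodel

open HasCopowers

variable {T : Signature.{u}} {C : Type v} [Category.{u} C] [HasCopowers C]

/-- Morphisms of comodels. -/
@[ext]
structure Hom (S S' : Comodel T C) where
  hom : S.obj ⟶ S'.obj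
  comm : ∀ σ : T.Op, S.coop σ ≫ copowerMap (T.Arity σ) hom = hom ≫ S'.coop σ

/-- The category `Comod(T, C)`. -/
instance : Category.{u} (Comodel T C) where
  Hom := Hom
  id S := ⟨𝟙 S.obj, fun σ => by simp [copowerMap_id]⟩
  comp f g := ⟨f.hom ≫ g.hom, fun σ => by
    rw [copowerMap_comp, ← Category.assoc, f.comm, Category.assoc, g.comm, Category.assoc]⟩

@[ext]
theorem hom_ext {S S' : Comodel T C} (f g : S ⟶ S') (h : f.hom = g.hom) : f = g :=
  Hom.ext h

/-- The derived co-operation `S ⟶ V · S` of a term with variables in `V`. -/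
def derived (S : Comodel T C) {V : Type u} : Term T V → (S.obj ⟶ copower V S.obj)
  | .var v => inj S.obj v
  | .op σ t => S.coop σ ≫ desc (fun i => S.derived (t i))

/-- The `T`-model structure on the hom-set `C(S, X)`: the operation `σ` sends a family `f` to
the composite of the co-operation `S ⟶ |σ| · S` with the copairing of `f`. -/
def homModel (S : Comodel T C) (X : C) : Model T where
  carrier := S.obj ⟶ X
  op σ f := S.coop σ ≫ desc f

/-- Postcomposition is a morphism of models, so that `C(S, -)` is a functor to `Mod(T)`. -/
def homModelMap (S : Comodel T C) {X Y : C} (g : X ⟶ Y) : S.homModel X ⟶ S.homModel Y :=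
  Model.Hom.mk (X := S.homModel X) (Y := S.homModel Y) (fun f => f ≫ g) (by
    intro σ f
    exact (Category.assoc _ _ _).trans (congrArg (S.coop σ ≫ ·) (desc_comp _ _)))

end Comodel

/-! ## Comodels in sets, and the final one -/

/-- In sets, `B · X` is `B × X`. -/
instance : HasCopowers.{u} (Type u) where
  copower B X := B × X
  inj _ b := TypeCat.ofHom (fun x => (b, x))
  desc f := TypeCat.ofHom (fun p => f p.1 p.2)
  inj_desc _ _ := rfl
  hom_ext g h e := by
    ext ⟨b, x⟩
    exact congrArg (fun k => (ConcreteCategory.hom k : _ → _) x) (e b)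

/-- The co-operation of a comodel in sets, as a function. -/
def Comodel.step {T : Signature.{u}} (S : Comodel T (Type u)) (σ : T.Op) :
    S.obj → T.Arity σ × S.obj :=
  fun s => S.coop σ s

/-- The derived co-operation of a comodel in sets, as a function: `t` is evaluated from the
initial state `s` to a value and a final state. -/
def Comodel.eval {T : Signature.{u}} (S : Comodel T (Type u)) {V : Type u} (t : Term T V) :
    S.obj → V × S.obj :=
  fun s => S.derived t s

theorem Comodel.eval_op {T : Signature.{u}} (S : Comodel T (Type u)) {V : Type u} (σ : T.Op)
    (t : T.Arity σ → Term T V) (s : S.obj) :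
    S.eval (.op σ t) s = S.eval (t (S.step σ s).1) (S.step σ s).2 := rfl

theorem Comodel.step_hom {T : Signature.{u}} {S S' : Comodel T (Type u)} (m : S ⟶ S')
    (σ : T.Op) (s : S.obj) :
    S'.step σ (m.hom s) = ((S.step σ s).1, m.hom (S.step σ s).2) :=
  (congrArg (fun k => (ConcreteCategory.hom k : _ → _) s) (m.comm σ)).symm

/-- The final `T`-comodel: its states are the functions that assign to each finite word of
symbols an element of `∏ σ, |σ|`; the output at `σ` is read off at the empty word and the next
state is `w ↦ s (σ w)`. -/
def finalComodel (T : Signature.{u}) : Comodel T (Type u) where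
  obj := List T.Op → ∀ σ : T.Op, T.Arity σ
  coop σ := TypeCat.ofHom (fun s => (s [] σ, fun w => s (σ :: w)))

/-- The behaviour of a state of an arbitrary comodel, as a state of the final comodel. -/
def behaviour {T : Signature.{u}} (S : Comodel T (Type u)) :
    List T.Op → S.obj → ∀ σ : T.Op, T.Arity σ
  | [], s, σ => (S.step σ s).1
  | τ :: w, s, σ => behaviour S w (S.step τ s).2 σ

/-- The comodel `finalComodel T` is final in `Comod(T)`. -/
def finalComodelIsTerminal (T : Signature.{u}) : IsTerminal (finalComodel T) :=
  IsTerminal.ofUniqueHom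
    (fun S => Comodel.Hom.mk (S := S) (S' := finalComodel T)
      (TypeCat.ofHom (fun s w => behaviour S w s)) (fun σ => rfl))
    (fun S m => by
      have key : ∀ (w : List T.Op) (s : S.obj),
          (m.hom s : List T.Op → ∀ σ : T.Op, T.Arity σ) w = behaviour S w s := by
        intro w
        induction w with
        | nil =>
          intro s
          funext σ
          exact congrArg Prod.fst (Comodel.step_hom m σ s)
        | cons τ w ih =>
          intro s
          exact (congrFun (congrArg Prod.snd (Comodel.step_hom m τ s)) w).trans (ih _)
      apply Comodel.hom_ext
      ext s
      funext w
      exact key w s)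

/-! ## Sets with a sub-basis -/

/-- A set with a sub-basis, i.e. a family of subsets that contains `∅` and the whole set. -/
structure Sub where
  carrier : Type u
  basis : Set (Set carrier)
  empty_mem : ∅ ∈ basis
  univ_mem : Set.univ ∈ basis

namespace Sub

/-- Functions continuous on sub-basis. -/
@[ext]
structure Hom (X Y : Sub.{u}) where
  toFun : X.carrier → Y.carrier
  preimage_mem : ∀ U ∈ Y.basis, toFun ⁻¹' U ∈ X.basis

/-- The category `Sub`. -/
instance : Category.{u} Sub.{u} where
  Hom := Hom
  id X := ⟨fun x => x, fun _ h => h⟩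
  comp f g := ⟨fun x => g.toFun (f.toFun x), fun U h => f.preimage_mem _ (g.preimage_mem U h)⟩

@[ext]
theorem hom_ext {X Y : Sub.{u}} (f g : X ⟶ Y) (h : ∀ x, f.toFun x = g.toFun x) : f = g :=
  Hom.ext (funext h)

/-- The copower `B · X` in `Sub`: the set `B × X` with the sets all of whose slices belong to the
sub-basis of `X`. -/
def copower (B : Type u) (X : Sub.{u}) : Sub.{u} where
  carrier := B × X.carrier
  basis := {U | ∀ b : B, {x | (b, x) ∈ U} ∈ X.basis}
  empty_mem := fun _ => X.empty_mem
  univ_mem := fun _ => X.univ_mem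

instance : HasCopowers.{u} Sub.{u} where
  copower := copower
  inj X b := Hom.mk (Y := copower _ X) (fun x => (b, x)) (fun _ h => h b)
  desc {_ X _} f := Hom.mk (X := copower _ X) (fun p => (f p.1).toFun p.2)
    (fun U h b => (f b).preimage_mem U h)
  inj_desc _ _ := rfl
  hom_ext g h e := by
    apply Sub.hom_ext
    rintro ⟨b, x⟩
    exact congrFun (congrArg Hom.toFun (e b)) x

end Sub

namespace Comodel

variable {T : Signature.{u}}

/-- The set `[t ↦ v]` of the states at which the evaluation of `t` returns `v`. -/
def returns (S : Comodel T (Type u)) {V : Type u} (t : Term T V) (v : V) : Set S.obj :=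
  {s | (S.eval t s).1 = v}

theorem eval_rename (S : Comodel T (Type u)) {V W : Type u} (f : V → W) (t : Term T V) :
    ∀ s : S.obj, S.eval (t.rename f) s = (f (S.eval t s).1, (S.eval t s).2) := by
  induction t with
  | var v => intro s; rfl
  | op σ t ih => intro s; exact ih _ _

/-- The underlying set of a comodel, with the operational sub-basis. -/
def operationalSub (S : Comodel T (Type u)) : Sub.{u} where
  carrier := S.obj
  basis := {U | ∃ (V : Type u) (t : Term T V) (v : V), U = S.returns t v}
  empty_mem := ⟨ULift Bool, .var ⟨true⟩, ⟨false⟩, by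
    symm
    apply Set.eq_empty_of_forall_notMem
    intro s h
    have h' : (⟨true⟩ : ULift Bool) = ⟨false⟩ := h
    simp at h'⟩
  univ_mem := ⟨PUnit, .var PUnit.unit, PUnit.unit, by
    symm
    exact Set.eq_univ_of_forall (fun s => rfl)⟩

/-- A comodel in sets, made a comodel in `Sub` by its operational sub-basis. -/
def operational (S : Comodel T (Type u)) : Comodel T Sub.{u} where
  obj := S.operationalSub
  coop σ := Sub.Hom.mk (X := S.operationalSub)
    (Y := Sub.copower (T.Arity σ) S.operationalSub)
    (fun s => S.step σ s) (by
      intro U hU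
      choose V t v h using hU
      refine ⟨ULift Prop, .op σ (fun i => (t i).rename (fun w => ⟨w = v i⟩)), ⟨True⟩, ?_⟩
      apply Set.ext
      intro (s : S.obj)
      have e : S.eval (.op σ (fun i => (t i).rename (fun w => (⟨w = v i⟩ : ULift Prop)))) s = _ :=
        (S.eval_op σ _ s).trans (S.eval_rename _ _ _)
      have h1 : ((S.step σ s).1, (S.step σ s).2) ∈ U ↔
          (S.eval (t (S.step σ s).1) (S.step σ s).2).1 = v (S.step σ s).1 :=
        Set.ext_iff.mp (h (S.step σ s).1) (S.step σ s).2
      refine h1.trans (Iff.trans ?_ (Eq.congr_left (congrArg Prod.fst e)).symm)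
      exact ⟨fun h => congrArg ULift.up (eq_true h), fun h => of_eq_true (congrArg ULift.down h)⟩)

end Comodel

/-- The final comodel `S_T`, as a comodel in `Sub`. -/
def finalSub (T : Signature.{u}) : Comodel T Sub.{u} :=
  (finalComodel T).operational

/-- The comodel in sets that underlies a comodel in `Sub`. -/
def Comodel.forget {T : Signature.{u}} (S : Comodel T Sub.{u}) : Comodel T (Type u) where
  obj := S.obj.carrier
  coop σ := TypeCat.ofHom (fun s => ((S.coop σ).toFun s : T.Arity σ × S.obj.carrier))

theorem Comodel.returns_mem {T : Signature.{u}} (S : Comodel T Sub.{u}) {V : Type u}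
    (t : Term T V) : ∀ v : V, S.forget.returns t v ∈ S.obj.basis := by
  induction t with
  | var w =>
    intro v
    by_cases h : w = v
    · have : S.forget.returns (.var w) v = Set.univ := Set.eq_univ_of_forall (fun s => h)
      rw [this]; exact S.obj.univ_mem
    · have : S.forget.returns (.var w) v = ∅ :=
        Set.eq_empty_of_forall_notMem (fun s h' => h h')
      rw [this]; exact S.obj.empty_mem
  | op σ t ih =>
    intro v
    exact (S.coop σ).preimage_mem {p : T.Arity σ × S.obj.carrier | p.2 ∈ S.forget.returns (t p.1) v}
      (fun i => ih i v)

theorem Comodel.eval_hom_fst {T : Signature.{u}} {S S' : Comodel T (Type u)} (m : S ⟶ S')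
    {V : Type u} (t : Term T V) : ∀ s : S.obj,
      (S'.eval t (m.hom s)).1 = (S.eval t s).1 := by
  induction t with
  | var v => intro s; rfl
  | op σ t ih =>
    intro s
    rw [eval_op, eval_op, step_hom m]
    exact ih _ _

/-- The comodel `finalSub T` is final in `Comod(T, Sub)`. -/
def finalSubIsTerminal (T : Signature.{u}) : IsTerminal (finalSub T) :=
  IsTerminal.ofUniqueHom
    (fun S => Comodel.Hom.mk (S := S) (S' := finalSub T)
      (Sub.Hom.mk (Y := (finalComodel T).operationalSub)
        (fun s => ((finalComodelIsTerminal T).from S.forget).hom s) (by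
          rintro _ ⟨V, t, v, rfl⟩
          refine (congrArg (· ∈ S.obj.basis) (Set.ext fun s => ?_)).mpr (S.returns_mem t v)
          exact Eq.congr_left
            (Comodel.eval_hom_fst ((finalComodelIsTerminal T).from S.forget) t s)))
      (fun σ => by
        apply Sub.hom_ext
        intro s
        exact congrArg (fun k => (ConcreteCategory.hom k : _ → _) s)
          (((finalComodelIsTerminal T).from S.forget).comm σ)))
    (fun S m => by
      apply Comodel.hom_ext
      apply Sub.hom_ext
      intro s
      let m' : S.forget ⟶ finalComodel T :=
        Comodel.Hom.mk (S := S.forget) (S' := finalComodel T)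
          (TypeCat.ofHom (fun s : S.obj.carrier => m.hom.toFun s)) (fun σ => by
            ext x
            exact congrFun (congrArg Sub.Hom.toFun (m.comm σ)) x)
      exact congrArg (fun k : S.forget ⟶ finalComodel T => (ConcreteCategory.hom k.hom : _ → _) s)
        ((finalComodelIsTerminal T).hom_ext m' ((finalComodelIsTerminal T).from S.forget)))

/-! ## Residual comodels, the extent, and `reflect` -/

/-- A `T`-residual `T'`-comodel, i.e. a `T'`-comodel in the Kleisli category of `T`. -/
structure ResidualComodel (T T' : Signature.{u}) where
  carrier : Type u
  coop : ∀ τ : T'.Op, carrier → Term T (T'.Arity τ × carrier)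

namespace ResidualComodel

open HasCopowers

variable {T T' : Signature.{u}}

/-- Maps of residual comodels. -/
@[ext]
structure Hom (R R' : ResidualComodel T T') where
  toFun : R.carrier → R'.carrier
  comm : ∀ (τ : T'.Op) (r : R.carrier),
    (R.coop τ r).rename (fun p => (p.1, toFun p.2)) = R'.coop τ (toFun r)

instance : Category.{u} (ResidualComodel T T') where
  Hom := Hom
  id R := ⟨fun r => r, fun τ r => Term.rename_id _⟩
  comp f g := ⟨fun r => g.toFun (f.toFun r), fun τ r => by
    rw [← g.comm, ← f.comm, Term.rename_rename]
    rfl⟩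

@[ext]
theorem hom_ext {R R' : ResidualComodel T T'} (f g : R ⟶ R')
    (h : ∀ r, f.toFun r = g.toFun r) : f = g :=
  Hom.ext (funext h)

/-- The tensor product `R · M` of a residual comodel and a `T`-comodel `M` in `C`: the
`T'`-comodel on the copower of `M` by the set of states of `R` that, in a state `r` of `R`,
evaluates the term `R.coop τ r` in `M`. -/
def tensor {C : Type v} [Category.{u} C] [HasCopowers C] (R : ResidualComodel T T')
    (M : Comodel T C) : Comodel T' C where
  obj := copower R.carrier M.obj
  coop τ := desc (fun r => M.derived (R.coop τ r) ≫
    desc (fun p => inj M.obj p.2 ≫ inj (copower R.carrier M.obj) p.1))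

/-- The extent `R · S_T ⟶ S_{T'}`, a morphism of `Sub`. -/
noncomputable def extent (R : ResidualComodel T T') :
    copower R.carrier (finalSub T).obj ⟶ (finalSub T').obj :=
  ((finalSubIsTerminal T').from (R.tensor (finalSub T))).hom

/-- The currying of the extent. -/
noncomputable def reflect (R : ResidualComodel T T') (r : R.carrier) :
    (finalSub T).obj ⟶ (finalSub T').obj :=
  inj (finalSub T).obj r ≫ R.extent

end ResidualComodel

/-! ## Copowers of models and bimodels

Here no arity of `T` is empty. -/

/-- The canonical terms: no sub-term is of the form `σ(λ i. (b, x i))`. -/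
def Term.Canonical {T : Signature.{u}} {B X : Type u} : Term T (B × X) → Prop
  | .var _ => True
  | .op σ t => (∀ i, (t i).Canonical) ∧
      ¬ ∃ (b : B) (x : T.Arity σ → X), ∀ i, t i = .var (b, x i)

namespace Model

variable {T : Signature.{u}}

open Classical in
/-- The copower `B · X` of a model: the canonical terms in `T(B × X)`, with the operations of
`T(B × X)` except that `σ(λ i. (b, x i))` is the variable `(b, σ(λ i. x i))`. -/
noncomputable def copower (B : Type u) (X : Model T) : Model T where
  carrier := {t : Term T (B × X.carrier) // t.Canonical}
  op σ t :=
    if h : ∃ (b : B) (x : T.Arity σ → X.carrier), ∀ i, (t i).1 = .var (b, x i) then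
      ⟨.var (h.choose, X.op σ h.choose_spec.choose), trivial⟩
    else ⟨.op σ (fun i => (t i).1), fun i => (t i).2, h⟩

theorem copower_op_pos [∀ σ : T.Op, Nonempty (T.Arity σ)] {B : Type u} {X : Model T}
    (σ : T.Op) (t : T.Arity σ → (copower B X).carrier) (b : B) (x : T.Arity σ → X.carrier)
    (h : ∀ i, (t i).1 = .var (b, x i)) :
    (copower B X).op σ t = ⟨.var (b, X.op σ x), trivial⟩ := by
  have h' : ∃ (b : B) (x : T.Arity σ → X.carrier), ∀ i, (t i).1 = .var (b, x i) := ⟨b, x, h⟩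
  have e : ∀ i, h'.choose = b ∧ h'.choose_spec.choose i = x i := by
    intro i
    have := (h'.choose_spec.choose_spec i).symm.trans (h i)
    simpa using this
  have e1 : h'.choose = b := (e (Classical.arbitrary _)).1
  have e2 : h'.choose_spec.choose = x := funext (fun i => (e i).2)
  refine (dif_pos h').trans (Subtype.ext ?_)
  exact congrArg₂ (fun c y => Term.var (c, X.op σ y)) e1 e2

theorem copower_op_neg {B : Type u} {X : Model T}
    (σ : T.Op) (t : T.Arity σ → (copower B X).carrier)
    (h : ¬ ∃ (b : B) (x : T.Arity σ → X.carrier), ∀ i, (t i).1 = .var (b, x i)) :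
    (copower B X).op σ t = ⟨.op σ (fun i => (t i).1), fun i => (t i).2, h⟩ := by
  simp only [copower]
  rw [dif_neg h]

noncomputable instance [∀ σ : T.Op, Nonempty (T.Arity σ)] : HasCopowers.{u} (Model T) where
  copower := copower
  inj {B} X b := Hom.mk (X := X) (Y := copower B X) (fun x => ⟨.var (b, x), trivial⟩)
    (fun σ x => (copower_op_pos σ _ b x (fun _ => rfl)).symm)
  desc {B X Y} f := Hom.mk (X := copower B X) (Y := Y)
    (fun t => Y.interp (fun p => (f p.1).toFun p.2) t.1) (by
      intro σ t
      by_cases h : ∃ (b : B) (x : T.Arity σ → X.carrier), ∀ i, (t i).1 = .var (b, x i)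
      · obtain ⟨b, x, h⟩ := h
        rw [copower_op_pos σ t b x h]
        simp only [h, interp]
        exact (f b).map_op σ x
      · rw [copower_op_neg σ t h]
        rfl)
  inj_desc _ _ := rfl
  hom_ext {B X Y} g h e := by
    apply Model.hom_ext
    rintro ⟨t, ht⟩
    induction t with
    | var p => exact congrFun (congrArg Hom.toFun (e p.1)) p.2
    | op σ t ih =>
      have : (⟨.op σ t, ht⟩ : (copower B X).carrier) =
          (copower B X).op σ (fun i => ⟨t i, ht.1 i⟩) :=
        (copower_op_neg σ (fun i => ⟨t i, ht.1 i⟩) ht.2).symm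
      rw [this]
      exact (g.map_op σ _).trans ((congrArg (Y.op σ) (funext fun i => ih i (ht.1 i))).trans
        (h.map_op σ _).symm)

end Model

section Bimodels

open HasCopowers

variable (T T' : Signature.{u}) [∀ σ : T.Op, Nonempty (T.Arity σ)]

/-- A `T`-`T'`-bimodel, i.e. a `T'`-comodel in the category of `T`-models. -/
abbrev Bimodel := Comodel T' (Model T)

variable {T T'}

/-- The residual comodel of a bimodel, by the inclusion of `|τ| · K` into `T(|τ| × K)`. -/
def Bimodel.residual (K : Bimodel T T') : ResidualComodel T T' where
  carrier := K.obj.carrier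
  coop τ k := ((K.coop τ).toFun k).1

/-- The canonical morphism `B · C(S, X) ⟶ C(S, B · X)` of models. -/
noncomputable def Comodel.comparison {C : Type v} [Category.{u} C] [HasCopowers C]
    (S : Comodel T C) (B : Type u) (X : C) :
    copower B (S.homModel X) ⟶ S.homModel (copower B X) :=
  desc (fun b => S.homModelMap (inj X b))

/-- The bimodel `Sub(S_T, S_{T'})`, whose co-operations are postcomposition with those of
`S_{T'}` followed by the inverses of the canonical morphisms
`|τ| · Sub(S_T, S_{T'}) ⟶ Sub(S_T, |τ| · S_{T'})`. -/
noncomputable def subBimodel (T T' : Signature.{u}) [∀ σ : T.Op, Nonempty (T.Arity σ)]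
    [∀ τ : T'.Op, IsIso ((finalSub T).comparison (T'.Arity τ) (finalSub T').obj)] :
    Bimodel T T' where
  obj := (finalSub T).homModel (finalSub T').obj
  coop τ := (finalSub T).homModelMap ((finalSub T').coop τ) ≫
    inv ((finalSub T).comparison (T'.Arity τ) (finalSub T').obj)

/-- The map from the bimodel `Sub(S_T, S_{T'})` to a final residual comodel. -/
noncomputable def reify [∀ τ : T'.Op, IsIso
      ((finalSub T).comparison (T'.Arity τ) (finalSub T').obj)]
    {I : ResidualComodel T T'} (hI : IsTerminal I) :
    ((finalSub T).obj ⟶ (finalSub T').obj) → I.carrier :=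
  (hI.from (subBimodel T T').residual).toFun

end Bimodels

end FreeTheory

namespace FreeTheory

open HasCopowers

/-! A sub-basic set of `S_T` is read by a single term, hence is trivial or depends only on the
output at one operation σ and on the state after σ. The data belonging to distinct operations are
independent, so a function that depends on two of them in this way is constant.

For the isomorphism in part 1, a canonical term represents the map that evaluates it. Injectivity:
if its value in `B` is constant, canonicity forces it to be a variable; otherwise its root is the
only operation through which the map factors (`Term.Canonical.run_injective`). Surjectivity: a map
to `B · X` whose first component is not constant factors through one operation (`exists_factors`).
If splitting it along such operations never ended, there would be a state along which the first
component stays undetermined. But the fibre of the first component through that state is read by one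
well-founded term, which is a contradiction (`comparison_surjective`). Both halves need states to
exist, hence nonempty arities.

Everything else rests on corecursion: `reflect` is the only family of maps compatible with
evaluation (`ResidualComodel.Compatible.unique`), and bimodel morphisms to `Sub(S_T, S_{T'})` are
the compatible morphisms of models. So the extent is the unique such morphism, and for the final
bimodel it is the identity. Since `reflect` is natural in the residual comodel, `reflect ∘ reify` is
that identity. A final residual comodel exists because `R ↦ ∏ τ, T(|τ| × R)` is polynomial. -/

/-! ## States of the final comodel -/

section States

variable {T : Signature.{u}}

/-- The states of the final comodel. -/
abbrev State (T : Signature.{u}) : Type u := List T.Op → ∀ σ : T.Op, T.Arity σ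

/-- The state that remains after the operation `σ`. -/
abbrev State.tail (s : State T) (σ : T.Op) : State T := fun w => s (σ :: w)

/-- The evaluation of a term at a state of the final comodel. -/
abbrev State.eval {V : Type u} (t : Term T V) (s : State T) : V × State T :=
  (finalComodel T).eval t s

open Classical in
/-- The state that agrees with `s` on all words starting with `σ`, and with `s'` elsewhere. -/
noncomputable def State.splice (σ : T.Op) (s s' : State T) : State T
  | [], τ => if τ = σ then s [] τ else s' [] τ
  | τ :: w, ρ => if τ = σ then s (τ :: w) ρ else s' (τ :: w) ρ

open Classical in
/-- A state that returns `i` at `σ` and continues as `s` after `σ`. -/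
noncomputable def State.cons [∀ σ : T.Op, Nonempty (T.Arity σ)] (σ : T.Op) (i : T.Arity σ)
    (s : State T) : State T
  | [] => Function.update (fun _ => Classical.arbitrary _) σ i
  | τ :: w => if τ = σ then s w else fun _ => Classical.arbitrary _

/-- The function `f` depends only on the output at `σ` and on the state after `σ`. -/
def Factors {Z : Sort*} (σ : T.Op) (f : State T → Z) : Prop :=
  ∀ s s' : State T, s [] σ = s' [] σ → s.tail σ = s'.tail σ → f s = f s'

/-- The words that begin with σ, together with the output at σ, form a block of coordinates that can
be prescribed independently of all the others. -/
theorem State.splice_head (σ : T.Op) (s s' : State T) : s.splice σ s' [] σ = s [] σ := by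
  simp [splice]

theorem State.splice_tail (σ : T.Op) (s s' : State T) :
    State.tail (s.splice σ s') σ = s.tail σ := by
  funext w ρ
  simp [splice, tail]

theorem State.splice_head_of_ne {σ τ : T.Op} (h : τ ≠ σ) (s s' : State T) :
    s.splice σ s' [] τ = s' [] τ := by
  simp [splice, h]

theorem State.splice_tail_of_ne {σ τ : T.Op} (h : τ ≠ σ) (s s' : State T) :
    State.tail (s.splice σ s') τ = s'.tail τ := by
  funext w ρ
  simp [splice, tail, h]

theorem Factors.splice {Z : Sort*} {σ : T.Op} {f : State T → Z} (hf : Factors σ f)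
    (s s' : State T) : f (s.splice σ s') = f s :=
  hf _ _ (State.splice_head σ s s') (State.splice_tail σ s s')

theorem Factors.splice_of_ne {Z : Sort*} {σ τ : T.Op} {f : State T → Z} (hf : Factors τ f)
    (h : τ ≠ σ) (s s' : State T) : f (s.splice σ s') = f s' :=
  hf _ _ (State.splice_head_of_ne h s s') (State.splice_tail_of_ne h s s')

/-- A function that factors through two distinct operations is constant. -/
theorem Factors.const {Z : Sort*} {σ τ : T.Op} {f : State T → Z} (hσ : Factors σ f)
    (hτ : Factors τ f) (h : τ ≠ σ) (s s' : State T) : f s = f s' :=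
  (hσ.splice s s').symm.trans (hτ.splice_of_ne h s s')

theorem State.eval_op {V : Type u} (σ : T.Op) (t : T.Arity σ → Term T V) (s : State T) :
    State.eval (.op σ t) s = State.eval (t (s [] σ)) (s.tail σ) := rfl

theorem factors_eval_op {V : Type u} (σ : T.Op) (t : T.Arity σ → Term T V) :
    Factors σ (fun s => State.eval (.op σ t) s) := by
  intro s s' h h'
  simp only [State.eval_op, h, h']

/-- A set of the operational sub-basis is trivial, or its membership predicate factors through
some operation. -/
theorem exists_factors_of_mem_basis {U : Set (State T)} (hU : U ∈ (finalSub T).obj.basis) :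
    U = ∅ ∨ U = Set.univ ∨ ∃ σ, Factors σ (· ∈ U) := by
  obtain ⟨V, t, v, rfl⟩ := hU
  cases t with
  | var w =>
    by_cases h : w = v
    · exact .inr (.inl (Set.eq_univ_of_forall fun _ => h))
    · exact .inl (Set.eq_empty_of_forall_notMem fun _ h' => h h')
  | op σ t =>
    refine .inr (.inr ⟨σ, fun s s' h h' => ?_⟩)
    exact congrArg (fun p : V × State T => p.1 = v) (factors_eval_op σ t s s' h h')

variable [∀ σ : T.Op, Nonempty (T.Arity σ)]

theorem State.cons_head (σ : T.Op) (i : T.Arity σ) (s : State T) : s.cons σ i [] σ = i := by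
  simp [cons]

theorem State.cons_tail (σ : T.Op) (i : T.Arity σ) (s : State T) :
    State.tail (s.cons σ i) σ = s := by
  funext w
  simp [cons, tail]

theorem State.eval_cons {V : Type u} (σ : T.Op) (t : T.Arity σ → Term T V) (i : T.Arity σ)
    (s : State T) : State.eval (.op σ t) (s.cons σ i) = State.eval (t i) s := by
  rw [State.eval_op, cons_head, cons_tail]

theorem Factors.cons {Z : Sort*} {σ : T.Op} {f : State T → Z} (hf : Factors σ f)
    (s : State T) : f ((s.tail σ).cons σ (s [] σ)) = f s :=
  hf _ _ (State.cons_head ..) (State.cons_tail ..)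

/-- `State.cons` as a morphism of `Sub`. -/
noncomputable def consHom (σ : T.Op) (i : T.Arity σ) : (finalSub T).obj ⟶ (finalSub T).obj :=
  Sub.Hom.mk (X := (finalSub T).obj) (Y := (finalSub T).obj) (fun s => State.cons σ i s) (by
    intro U hU
    obtain ⟨V, t, v, rfl⟩ := hU
    cases t with
    | var w => exact ⟨V, .var w, v, rfl⟩
    | op τ t =>
      by_cases h : τ = σ
      · subst h
        refine ⟨V, t i, v, Set.ext fun s => ?_⟩
        exact Eq.congr_left (congrArg Prod.fst (State.eval_cons τ t i s))
      -- After an operation other than σ, `State.cons` holds only default values, so the result does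
      -- not depend on `s`. A variable carrying the value at any reference state reads it.
      · let s₀ : State T := fun _ _ => Classical.arbitrary _
        refine ⟨V, .var (State.eval (.op τ t) (State.cons σ i s₀)).1, v, Set.ext fun s => ?_⟩
        have e : (State.eval (.op τ t) (State.cons σ i s)).1 =
            (State.eval (.op τ t) (s₀.cons σ i)).1 :=
          congrArg Prod.fst <| factors_eval_op τ t _ _ (by simp [State.cons, h])
            (by funext w; simp [State.cons, State.tail, h])
        exact Eq.congr_left e)

end States

/-! ## Hom-sets out of the final comodel -/

section Comparison

variable {T : Signature.{u}}

theorem derived_finalSub_apply {V : Type u} (t : Term T V) : ∀ s : State T,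
    ((finalSub T).derived t).toFun s = State.eval t s := by
  induction t with
  | var v => intro s; rfl
  | op σ t ih => intro s; exact ih _ _

/-- Operations in a hom-model choose a branch by the current output, so interpreting a term amounts
to evaluating it and applying the morphism found at the leaf to the remaining state. -/
theorem interp_homModel_apply {X : Sub.{u}} {V : Type u} (ρ : V → ((finalSub T).obj ⟶ X))
    (t : Term T V) : ∀ s : State T,
    (((finalSub T).homModel X).interp ρ t : (finalSub T).obj ⟶ X).toFun s =
      (ρ (State.eval t s).1).toFun (State.eval t s).2 := by
  induction t with
  | var v => intro s; rfl
  | op σ t ih => intro s; exact ih _ _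

theorem Model.isIso_of_bijective {Y Z : Model T} (f : Y ⟶ Z) (hf : Function.Bijective f.toFun) :
    IsIso f := by
  let e := Equiv.ofBijective f.toFun hf
  refine ⟨Model.Hom.mk (X := Z) (Y := Y) e.symm fun σ x => ?_, ?_, ?_⟩
  · rw [Equiv.symm_apply_eq]
    refine Eq.trans ?_ (f.map_op σ _).symm
    exact congrArg (Z.op σ) (funext fun j => (e.apply_symm_apply (x j)).symm)
  · exact Model.hom_ext _ _ fun x => e.symm_apply_apply x
  · exact Model.hom_ext _ _ fun x => e.apply_symm_apply x

/-- A `Sub` is separated if the sub-basis distinguishes its points. -/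
def Sub.Separated (X : Sub.{u}) : Prop :=
  ∀ x y : X.carrier, (∀ U ∈ X.basis, x ∈ U ↔ y ∈ U) → x = y

/-- The term that performs the operations in a word, and then `σ`. -/
def Term.ofWord (σ : T.Op) : List T.Op → Term T (ULift.{u} (Σ τ : T.Op, T.Arity τ))
  | [] => .op σ (fun i => .var ⟨σ, i⟩)
  | τ :: w => .op τ (fun _ => Term.ofWord σ w)

theorem State.eval_ofWord (σ : T.Op) (w : List T.Op) : ∀ s : State T,
    (State.eval (Term.ofWord σ w) s).1 = ⟨⟨σ, s w σ⟩⟩ := by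
  induction w with
  | nil => intro s; rfl
  | cons τ w ih => intro s; exact ih (s.tail τ)

/-- Each coordinate `s w σ` is the value returned by a term, namely `Term.ofWord σ w`. -/
theorem finalSub_separated (T : Signature.{u}) : (finalSub T).obj.Separated := by
  intro (s : State T) (s' : State T) h
  funext w σ
  have := (h _ ⟨_, Term.ofWord σ w, ⟨⟨σ, s w σ⟩⟩, rfl⟩).mp (State.eval_ofWord σ w s)
  have e := (State.eval_ofWord σ w s').symm.trans this
  simpa using e.symm

/-! ### Injectivity of the comparison: canonical terms are determined by evaluation -/

section Canonical

variable {B : Type u} {X : Sub.{u}}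

/-- The value at `s` of a term whose variables are pairs of an element of `B` and a morphism. -/
def Term.run (t : Term T (B × ((finalSub T).obj ⟶ X))) (s : State T) : B × X.carrier :=
  ((State.eval t s).1.1, (State.eval t s).1.2.toFun (State.eval t s).2)

theorem Term.run_op (σ : T.Op) (t : T.Arity σ → Term T (B × ((finalSub T).obj ⟶ X)))
    (s : State T) : (Term.op σ t).run s = (t (s [] σ)).run (s.tail σ) := rfl

theorem Term.factors_run_op (σ : T.Op) (t : T.Arity σ → Term T (B × ((finalSub T).obj ⟶ X))) :
    Factors σ (Term.op σ t).run := by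
  intro s s' h h'
  simp only [Term.run_op, h, h']

variable [∀ σ : T.Op, Nonempty (T.Arity σ)]

theorem Term.run_op_cons (σ : T.Op) (t : T.Arity σ → Term T (B × ((finalSub T).obj ⟶ X)))
    (i : T.Arity σ) (s : State T) : (Term.op σ t).run (s.cons σ i) = (t i).run s := by
  rw [run_op, State.cons_head, State.cons_tail]

theorem comparison_apply (t : (copower B ((finalSub T).homModel X) : Model T).carrier)
    (s : State T) :
    (((finalSub T).comparison B X).toFun t : (finalSub T).obj ⟶ copower B X).toFun s =
      t.1.run s :=
  interp_homModel_apply (fun p : B × ((finalSub T).obj ⟶ X) => p.2 ≫ inj X p.1) t.1 s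

/-- A canonical term whose value in `B` is constant is a variable. -/
theorem Term.Canonical.eq_var {t : Term T (B × ((finalSub T).obj ⟶ X))} (ht : t.Canonical)
    {b : B} (h : ∀ s, (t.run s).1 = b) : ∃ f, t = .var (b, f) := by
  induction t with
  | var p =>
    obtain ⟨b', f⟩ := p
    have : b' = b := h (fun _ _ => Classical.arbitrary _)
    exact ⟨f, by rw [this]⟩
  | op σ t ih =>
    -- Every branch has the same constant value, so all are variables over one `b`: the form that
    -- canonicity excludes.
    have hi : ∀ i, ∃ f, t i = .var (b, f) := fun i =>
      ih i (ht.1 i) fun s => by rw [← run_op_cons, h]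
    choose f hf using hi
    exact (ht.2 ⟨b, f, hf⟩).elim

/-- By `Term.Canonical.eq_var`, a variable can agree only with a variable. Two terms with the same
root are compared branch by branch. -/
theorem Term.Canonical.run_injective {t : Term T (B × ((finalSub T).obj ⟶ X))}
    (ht : t.Canonical) {t' : Term T (B × ((finalSub T).obj ⟶ X))} (ht' : t'.Canonical)
    (h : ∀ s, t.run s = t'.run s) : t = t' := by
  induction t generalizing t' with
  | var p =>
    obtain ⟨b, f⟩ := p
    obtain ⟨f', rfl⟩ := ht'.eq_var (b := b) fun s => by rw [← h]; rfl
    have : f = f' := Sub.hom_ext _ _ fun s => congrArg Prod.snd (h s)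
    rw [this]
  | op σ t ih =>
    have hvar : ∀ b f, Term.op σ t ≠ .var (b, f) := fun _ _ e => by cases e
    cases t' with
    | var p =>
      obtain ⟨b, f⟩ := p
      obtain ⟨f', e⟩ := ht.eq_var (b := b) fun s => by rw [h]; rfl
      exact (hvar _ _ e).elim
    | op τ t' =>
      by_cases hτ : τ = σ
      · subst hτ
        congr 1
        funext i
        exact ih i (ht.1 i) (ht'.1 i) fun s => by rw [← run_op_cons, ← run_op_cons, h]
      -- With distinct roots the common function factors through both, hence is constant, and a
      -- canonical term headed by an operation cannot be.
      · have hf : Factors τ (Term.op σ t).run := by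
          rw [funext h]
          exact factors_run_op τ t'
        let s₀ : State T := fun _ _ => Classical.arbitrary _
        obtain ⟨f, e⟩ := ht.eq_var (b := ((Term.op σ t).run s₀).1) fun s =>
          congrArg Prod.fst ((factors_run_op σ t).const hf hτ s s₀)
        exact (hvar _ _ e).elim

end Canonical

/-! ### Surjectivity of the comparison -/

section Surjective

variable {B : Type u} {X : Sub.{u}}

/-- The slices of `{b} × W` are `W` and `∅`, both sub-basic. -/
theorem preimage_slice_mem (g : (finalSub T).obj ⟶ copower B X) (b : B) {W : Set X.carrier}
    (hW : W ∈ X.basis) : {s | (g.toFun s).1 = b ∧ (g.toFun s).2 ∈ W} ∈ (finalSub T).obj.basis := by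
  refine g.preimage_mem {p | p.1 = b ∧ p.2 ∈ W} fun b' => ?_
  by_cases h : b' = b
  · exact (congrArg (· ∈ X.basis) (Set.ext fun x => and_iff_right h)).mpr hW
  · exact (congrArg (· ∈ X.basis) (Set.ext fun x =>
      iff_of_false (fun k => h k.1) id)).mpr X.empty_mem

theorem preimage_fst_mem (g : (finalSub T).obj ⟶ copower B X) (b : B) :
    {s | (g.toFun s).1 = b} ∈ (finalSub T).obj.basis := by
  simpa using preimage_slice_mem g b X.univ_mem

/-- A morphism to `B · X` whose first component is not constant factors through an operation. -/
theorem exists_factors (hX : X.Separated) (g : (finalSub T).obj ⟶ copower B X) {s₁ s₂ : State T}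
    (h₁₂ : (g.toFun s₁).1 ≠ (g.toFun s₂).1) : ∃ σ, Factors σ g.toFun := by
  obtain ⟨σ, hσ⟩ : ∃ σ, Factors σ (fun s => (g.toFun s).1 = (g.toFun s₁).1) := by
    rcases exists_factors_of_mem_basis (preimage_fst_mem g (g.toFun s₁).1) with h | h | h
    · exact (Set.eq_empty_iff_forall_notMem.mp h s₁ rfl).elim
    · exact (h₁₂ (Set.eq_univ_iff_forall.mp h s₂).symm).elim
    · exact h
  -- The operation σ found for one fibre serves all of these sets. If a nonempty one factored
  -- through τ ≠ σ, splicing the τ-part of a member into `s₁` and into `s₂` would give both the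
  -- first component `b` while leaving the σ-predicate unchanged, so `s₁` and `s₂` would lie in the
  -- same fibre.
  have key : ∀ b, ∀ W ∈ X.basis,
      Factors σ (fun s => (g.toFun s).1 = b ∧ (g.toFun s).2 ∈ W) := by
    intro b W hW
    have hmem := preimage_slice_mem g b hW
    rcases exists_factors_of_mem_basis hmem with h | h | ⟨τ, hτ⟩
    · have h' := Set.eq_empty_iff_forall_notMem.mp h
      exact fun s s' _ _ => (eq_false (h' s)).trans (eq_false (h' s')).symm
    · have h' := Set.eq_univ_iff_forall.mp h
      exact fun s s' _ _ => (eq_true (h' s)).trans (eq_true (h' s')).symm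
    · by_cases hτσ : σ = τ
      · exact hτσ ▸ hτ
      · have h' : ∀ s, ¬ ((g.toFun s).1 = b ∧ (g.toFun s).2 ∈ W) := by
          intro s hs
          have hs' : ∀ s', (g.toFun (State.splice τ s s')).1 = b := fun s' =>
            ((hτ.splice s s').mpr hs).1
          have e₁ := (hσ.splice_of_ne hτσ s s₁).mpr rfl
          have e₂ := (hσ.splice_of_ne hτσ s s₂).mp ((hs' s₂).trans ((hs' s₁).symm.trans e₁))
          exact h₁₂ e₂.symm
        exact fun s s' _ _ => (eq_false (h' s)).trans (eq_false (h' s')).symm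
  -- `W = univ` determines the first component; the other `W` determine the second, as `X` is
  -- separated.
  refine ⟨σ, fun s s' h h' => ?_⟩
  have e : ∀ W ∈ X.basis, (g.toFun s').1 = (g.toFun s).1 ∧
      ((g.toFun s).2 ∈ W ↔ (g.toFun s').2 ∈ W) := by
    intro W hW
    have h₁ := ((key (g.toFun s).1 _ X.univ_mem s s' h h').mp ⟨rfl, trivial⟩).1
    have h₂ := iff_of_eq (key (g.toFun s).1 W hW s s' h h')
    exact ⟨h₁, fun k => (h₂.mp ⟨rfl, k⟩).2, fun k => (h₂.mpr ⟨h₁, k⟩).2⟩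
  exact Prod.ext (e _ X.univ_mem).1.symm (hX _ _ fun W hW => (e W hW).2)

variable [∀ σ : T.Op, Nonempty (T.Arity σ)]

/-- The morphism `g` is the value of a canonical term. -/
def Readable (g : (finalSub T).obj ⟶ copower B X) : Prop :=
  ∃ t, ((finalSub T).comparison B X).toFun t = g

theorem readable_of_const (g : (finalSub T).obj ⟶ copower B X) {b : B}
    (hg : ∀ s, (g.toFun s).1 = b) : Readable g := by
  let f : (finalSub T).obj ⟶ X :=
    Sub.Hom.mk (X := (finalSub T).obj) (Y := X) (fun s => (g.toFun s).2)
      (fun W hW => g.preimage_mem {p | p.2 ∈ W} (fun _ => hW))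
  refine ⟨⟨.var (b, f), trivial⟩, Sub.hom_ext _ _ fun s => ?_⟩
  exact (comparison_apply _ s).trans (Prod.ext (hg s).symm rfl)

/-- The terms that read the branches are combined by the operation σ of the copower. -/
theorem readable_of_factors (g : (finalSub T).obj ⟶ copower B X) {σ : T.Op}
    (hg : Factors σ g.toFun)
    (h : ∀ i, Readable (consHom σ i ≫ g)) :
    Readable g := by
  choose t ht using h
  refine ⟨(copower B ((finalSub T).homModel X) : Model T).op σ t, ?_⟩
  rw [((finalSub T).comparison B X).map_op]
  refine Sub.hom_ext _ _ fun s => ?_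
  simp only [ht]
  exact hg.cons s

/-- Every morphism from the final comodel to a copower of a separated object is the value of a
term: otherwise there is a state along which the morphism is never determined. -/
theorem comparison_surjective (hX : X.Separated) :
    Function.Surjective ((finalSub T).comparison B X).toFun := by
  classical
  by_contra hsurj
  let N : Type u := {g : (finalSub T).obj ⟶ copower B X //
    ¬ Readable g}
  have hstep : ∀ g : N, ∃ σ, Factors σ g.1.toFun ∧ ∃ i,
      ¬ Readable (consHom σ i ≫ g.1) := by
    rintro ⟨g, hg⟩
    have : ∃ s₁ s₂, (g.toFun s₁).1 ≠ (g.toFun s₂).1 := by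
      by_contra hc
      push Not at hc
      exact hg (readable_of_const g
        fun s => hc s (fun _ _ => Classical.arbitrary _))
    obtain ⟨s₁, s₂, h⟩ := this
    obtain ⟨σ, hσ⟩ := exists_factors hX g h
    refine ⟨σ, hσ, ?_⟩
    by_contra hc
    push Not at hc
    exact hg (readable_of_factors g hσ hc)
  choose σ hσ i hi using hstep
  let next : N → N := fun g => ⟨consHom (σ g) (i g) ≫ g.1, hi g⟩
  -- The bad state is the behaviour of a machine whose states are the unreadable morphisms: at `σ g`
  -- it outputs the unreadable branch `i g`. Its other outputs are arbitrary.
  let K : Comodel T (Type u) :=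
    { obj := N
      coop := fun τ => TypeCat.ofHom fun g : N =>
        (Function.update (fun _ => Classical.arbitrary _) (σ g) (i g) τ, next g) }
  let path (g : N) : State T := fun w => behaviour K w g
  have path_head : ∀ g, path g [] (σ g) = i g := fun g =>
    Function.update_self (σ g) (i g) (fun τ => Classical.arbitrary (T.Arity τ))
  have path_tail : ∀ g, (path g).tail (σ g) = path (next g) := fun g => rfl
  have path_value : ∀ g : N, (next g).1.toFun (path (next g)) = g.1.toFun (path g) := by
    intro g
    have := (hσ g).cons (path g)
    rw [path_head, path_tail] at this
    exact this
  -- Well-foundedness enters here. If the root of the term is `σ g`, following the branch `i g`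
  -- leads to `next g` and a smaller term. With any other root, or none, the fibre through `path g`
  -- is everything, so `g` would be readable.
  have main : ∀ (V : Type u) (v : V) (t : Term T V) (g : N),
      ¬ ∀ s, (g.1.toFun s).1 = (g.1.toFun (path g)).1 ↔ (State.eval t s).1 = v := by
    intro V v t
    induction t with
    | var w =>
      intro g h
      have hw : w = v := (h (path g)).mp rfl
      exact g.2 (readable_of_const g.1 fun s => (h s).mpr hw)
    | op τ t ih =>
      intro g h
      by_cases hτ : τ = σ g
      · subst hτ
        refine ih (i g) (next g) fun s => ?_
        rw [path_value, ← State.eval_cons (σ g) t (i g) s]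
        exact h (State.cons (σ g) (i g) s)
      · have h₁ : Factors (σ g) (fun s => (g.1.toFun s).1 = (g.1.toFun (path g)).1) :=
          fun s s' k k' =>
            congrArg (fun p : B × X.carrier => p.1 = _) (hσ g s s' k k')
        have h₂ : Factors τ (fun s => (g.1.toFun s).1 = (g.1.toFun (path g)).1) := by
          intro s s' k k'
          refine (propext (h s)).trans (Eq.trans ?_ (propext (h s')).symm)
          exact congrArg (fun p : V × State T => p.1 = v) (factors_eval_op τ t s s' k k')
        exact g.2 (readable_of_const g.1 fun s =>
          (h₁.const h₂ hτ (path g) s).mp rfl)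
  obtain ⟨g, hg⟩ : ∃ g, ¬ Readable g := by
    by_contra hc
    exact hsurj fun g => not_exists_not.mp hc g
  obtain ⟨V, t, v, h⟩ := preimage_fst_mem g (g.toFun (path ⟨g, hg⟩)).1
  exact main V v t ⟨g, hg⟩ fun s => Set.ext_iff.mp h s

/-- The canonical morphism `B · Sub(S_T, X) ⟶ Sub(S_T, B · X)` is invertible. -/
theorem isIso_comparison (hX : X.Separated) : IsIso ((finalSub T).comparison B X) := by
  refine Model.isIso_of_bijective _ ⟨fun t t' h => ?_, comparison_surjective hX⟩
  refine Subtype.ext (t.2.run_injective t'.2 fun s => ?_)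
  rw [← comparison_apply, ← comparison_apply, h]

end Surjective
end Comparison

/-! ## The extent -/

section Extent

variable {T T' : Signature.{u}}

/-- A family of maps between the states of the final comodels that is compatible with a residual
comodel. -/
def ResidualComodel.Compatible (R : ResidualComodel T T')
    (F : R.carrier → State T → State T') : Prop :=
  ∀ τ r s, F r s [] τ = (State.eval (R.coop τ r) s).1.1 ∧
    (F r s).tail τ = F (State.eval (R.coop τ r) s).1.2 (State.eval (R.coop τ r) s).2

/-- Compatibility prescribes the output and the continuation at every operation, so induction on the
word that is read determines the state. -/
theorem ResidualComodel.Compatible.unique {R : ResidualComodel T T'}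
    {F G : R.carrier → State T → State T'} (hF : R.Compatible F) (hG : R.Compatible G) :
    F = G := by
  have key : ∀ (w : List T'.Op) (r : R.carrier) (s : State T), F r s w = G r s w := by
    intro w
    induction w with
    | nil =>
      intro r s
      funext τ
      rw [(hF τ r s).1, (hG τ r s).1]
    | cons τ w ih =>
      intro r s
      have h₁ := congrFun (hF τ r s).2 w
      have h₂ := congrFun (hG τ r s).2 w
      exact h₁.trans ((ih _ _).trans h₂.symm)
  funext r s w
  exact key w r s

theorem ResidualComodel.compatible_reflect (R : ResidualComodel T T') :
    R.Compatible (fun r => (R.reflect r).toFun) := by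
  intro τ r s
  have h := congrFun (congrArg Sub.Hom.toFun
    (((finalSubIsTerminal T').from (R.tensor (finalSub T))).comm τ)) ((r, s) : R.carrier × State T)
  have e := derived_finalSub_apply (R.coop τ r) s
  have h' : ((State.eval (R.coop τ r) s).1.1,
      (R.reflect (State.eval (R.coop τ r) s).1.2).toFun (State.eval (R.coop τ r) s).2) =
      (((R.reflect r).toFun s : State T') [] τ, State.tail ((R.reflect r).toFun s) τ) := by
    rw [← e]
    exact h
  exact ⟨(congrArg Prod.fst h').symm, (congrArg Prod.snd h').symm⟩

theorem ResidualComodel.reflect_eq_of_compatible {R : ResidualComodel T T'}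
    {F : R.carrier → ((finalSub T).obj ⟶ (finalSub T').obj)}
    (hF : R.Compatible (fun r => (F r).toFun)) : R.reflect = F := by
  funext r
  exact Sub.hom_ext _ _ (congrFun (congrFun (R.compatible_reflect.unique hF) r))

/-- Renaming variables does not affect how a term is evaluated, so `R'.reflect ∘ m` is compatible
with `R`. -/
theorem ResidualComodel.reflect_naturality {R R' : ResidualComodel T T'} (m : R ⟶ R') :
    R.reflect = R'.reflect ∘ m.toFun := by
  refine reflect_eq_of_compatible fun τ r s => ?_
  have e : State.eval (R'.coop τ (m.toFun r)) s = _ :=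
    (congrArg (fun t => State.eval t s) (m.comm τ r)).symm.trans
      ((finalComodel T).eval_rename _ (R.coop τ r) s)
  have h := R'.compatible_reflect τ (m.toFun r) s
  rw [e] at h
  exact h

variable [∀ σ : T.Op, Nonempty (T.Arity σ)]

/-- The extent of a bimodel is a morphism of models. -/
theorem Bimodel.reflect_op (K : Bimodel T T') (σ : T.Op) (k : T.Arity σ → K.obj.carrier) :
    K.residual.reflect (K.obj.op σ k) =
      ((finalSub T).homModel (finalSub T').obj).op σ (fun i => K.residual.reflect (k i)) := by
  have key : ∀ (w : List T'.Op) (σ : T.Op) (k : T.Arity σ → K.obj.carrier) (s : State T),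
      (((K.residual.reflect (K.obj.op σ k)).toFun s : State T') w : ∀ τ, T'.Arity τ) =
        ((K.residual.reflect (k (s [] σ))).toFun (s.tail σ) : State T') w := by
    intro w
    -- The two cases in the definition of operations on the copower. Either σ is performed now, or
    -- it is postponed into the next state `K.obj.op σ x`.
    have hstep : ∀ (τ : T'.Op) (σ : T.Op) (k : T.Arity σ → K.obj.carrier) (s : State T),
        State.eval (K.residual.coop τ (K.obj.op σ k)) s =
          State.eval (K.residual.coop τ (k (s [] σ))) (s.tail σ) ∨
        ∃ (b : T'.Arity τ) (x : T.Arity σ → K.obj.carrier),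
          State.eval (K.residual.coop τ (K.obj.op σ k)) s = ((b, K.obj.op σ x), s) ∧
          State.eval (K.residual.coop τ (k (s [] σ))) (s.tail σ) =
            ((b, x (s [] σ)), s.tail σ) := by
      intro τ σ k s
      have e : K.residual.coop τ (K.obj.op σ k) =
          ((Model.copower (T'.Arity τ) K.obj).op σ (fun i => (K.coop τ).toFun (k i))).1 :=
        congrArg Subtype.val ((K.coop τ).map_op σ k)
      by_cases h : ∃ (b : T'.Arity τ) (x : T.Arity σ → K.obj.carrier),
          ∀ i, ((K.coop τ).toFun (k i)).1 = .var (b, x i)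
      · obtain ⟨b, x, h⟩ := h
        refine .inr ⟨b, x, ?_, ?_⟩
        · rw [e, Model.copower_op_pos σ _ b x h]
          rfl
        · exact congrArg (fun t => State.eval t (s.tail σ)) (h (s [] σ))
      · left
        rw [e, Model.copower_op_neg σ _ h]
        rfl
    have hc := K.residual.compatible_reflect
    induction w with
    | nil =>
      intro σ k s
      funext τ
      refine (hc τ _ s).1.trans (Eq.trans ?_ (hc τ _ (s.tail σ)).1.symm)
      rcases hstep τ σ k s with h | ⟨b, x, h, h'⟩
      · rw [h]
      · rw [h, h']
    | cons τ w ih =>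
      intro σ k s
      refine (congrFun (hc τ _ s).2 w).trans
        (Eq.trans ?_ (congrFun (hc τ _ (s.tail σ)).2 w).symm)
      rcases hstep τ σ k s with h | ⟨b, x, h, h'⟩
      · simp only [h]
      · simp only [h, h']
        -- When σ is postponed, the claim for the shorter word applies to the new family `x` at the
        -- same `s`; hence the quantification over `k` in `key`.
        exact ih σ x s
  refine Sub.hom_ext _ _ fun s => ?_
  funext w
  exact key w σ k s

/-- The extent of a bimodel, as a morphism of models. -/
noncomputable def Bimodel.reflectHom (K : Bimodel T T') :
    K.obj ⟶ (finalSub T).homModel (finalSub T').obj :=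
  Model.Hom.mk (X := K.obj) (Y := (finalSub T).homModel (finalSub T').obj)
    K.residual.reflect K.reflect_op

/-! ## The final bimodel -/

variable [∀ τ : T'.Op, IsIso ((finalSub T).comparison (T'.Arity τ) (finalSub T').obj)]

/-- A morphism of models from a bimodel is a morphism of bimodels to `Sub(S_T, S_{T'})` if and
only if it is compatible with evaluation. -/
theorem comm_subBimodel_iff (K : Bimodel T T')
    (m : K.obj ⟶ (finalSub T).homModel (finalSub T').obj) :
    (∀ τ, K.coop τ ≫ copowerMap (T'.Arity τ) m = m ≫ (subBimodel T T').coop τ) ↔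
      K.residual.Compatible (fun k => (m.toFun k : (finalSub T).obj ⟶ (finalSub T').obj).toFun) := by
  have lhs : ∀ (τ : T'.Op) (k : K.obj.carrier) (s : State T),
      (((K.coop τ ≫ copowerMap (T'.Arity τ) m) ≫
        (finalSub T).comparison (T'.Arity τ) (finalSub T').obj).toFun k :
          (finalSub T).obj ⟶ copower (T'.Arity τ) (finalSub T').obj).toFun s =
      ((State.eval (K.residual.coop τ k) s).1.1,
        (m.toFun (State.eval (K.residual.coop τ k) s).1.2 :
          (finalSub T).obj ⟶ (finalSub T').obj).toFun (State.eval (K.residual.coop τ k) s).2) := by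
    intro τ k s
    have e : copowerMap (T'.Arity τ) m ≫
        (finalSub T).comparison (T'.Arity τ) (finalSub T').obj =
        desc (fun b => m ≫ (finalSub T).homModelMap (inj (finalSub T').obj b)) := by
      apply HasCopowers.hom_ext
      intro b
      rw [← Category.assoc, copowerMap, inj_desc, Category.assoc, Comodel.comparison, inj_desc,
        inj_desc]
    rw [Category.assoc, e]
    exact interp_homModel_apply _ (K.residual.coop τ k) s
  -- Composing with the comparison removes its inverse from the co-operation, so that both sides can
  -- be evaluated at states.
  have hiff : ∀ τ, K.coop τ ≫ copowerMap (T'.Arity τ) m = m ≫ (subBimodel T T').coop τ ↔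
      (K.coop τ ≫ copowerMap (T'.Arity τ) m) ≫
        (finalSub T).comparison (T'.Arity τ) (finalSub T').obj =
      m ≫ (finalSub T).homModelMap ((finalSub T').coop τ) := by
    intro τ
    rw [← IsIso.eq_comp_inv, Category.assoc]
    rfl
  simp only [hiff]
  constructor
  · intro h τ k s
    have e := (lhs τ k s).symm.trans (congrArg
      (fun g : (finalSub T).obj ⟶ copower (T'.Arity τ) (finalSub T').obj => g.toFun s)
      (congrFun (congrArg Model.Hom.toFun (h τ)) k))
    exact ⟨(congrArg Prod.fst e).symm, (congrArg Prod.snd e).symm⟩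
  · intro h τ
    refine Model.hom_ext _ _ fun k => Sub.hom_ext _ _ fun s => (lhs τ k s).trans ?_
    exact Prod.ext (h τ k s).1.symm (h τ k s).2.symm

variable (T T') in
/-- The bimodel `Sub(S_T, S_{T'})` is final. -/
noncomputable def subBimodelIsTerminal : IsTerminal (subBimodel T T') :=
  IsTerminal.ofUniqueHom
    (fun K => Comodel.Hom.mk (S := K) (S' := subBimodel T T') K.reflectHom
      ((comm_subBimodel_iff K K.reflectHom).mpr K.residual.compatible_reflect))
    (fun K m => by
      apply Comodel.hom_ext
      apply Model.hom_ext
      intro k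
      exact (congrFun (ResidualComodel.reflect_eq_of_compatible
        ((comm_subBimodel_iff K m.hom).mp m.comm)) k).symm)

/-- The extent of the final bimodel is the identity. -/
theorem reflect_subBimodel : (subBimodel T T').residual.reflect = id :=
  -- The identity is a bimodel morphism, hence compatible.
  ResidualComodel.reflect_eq_of_compatible
    ((comm_subBimodel_iff (subBimodel T T') (𝟙 (subBimodel T T').obj)).mp
      (Comodel.Hom.comm (𝟙 (subBimodel T T'))))

end Extent

/-! ## The final residual comodel -/

section FinalResidual

variable {T T' : Signature.{u}}

/-- The occurrences of variables in a term. -/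
def Term.Pos {V : Type u} : Term T V → Type u
  | .var _ => PUnit
  | .op σ t => Σ i : T.Arity σ, (t i).Pos

/-- Attach an element of `R` to every occurrence of a variable. -/
def Term.fill {A R : Type u} : (t : Term T A) → (t.Pos → R) → Term T (A × R)
  | .var a, f => .var (a, f PUnit.unit)
  | .op σ t, f => .op σ (fun i => (t i).fill (fun p => f ⟨i, p⟩))

/-- Detach the elements of `R` from the variables of a term. -/
def Term.split {A R : Type u} : Term T (A × R) → Σ t : Term T A, t.Pos → R
  | .var p => ⟨.var p.1, fun _ => p.2⟩
  | .op σ t => ⟨.op σ (fun i => (t i).split.1), fun p => (t p.1).split.2 p.2⟩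

/-- With `Term.split_fill`, this identifies `T(A × R)` with pairs of a shape in `T(A)` and a
labelling of its leaves by `R`, so that the functor is polynomial in `R`. -/
theorem Term.fill_split {A R : Type u} (t : Term T (A × R)) : t.split.1.fill t.split.2 = t := by
  induction t with
  | var p => rfl
  | op σ t ih => exact congrArg (Term.op σ) (funext ih)

theorem Term.split_fill {A R : Type u} (t : Term T A) (f : t.Pos → R) :
    (t.fill f).split = ⟨t, f⟩ := by
  induction t with
  | var a => rfl
  | op σ t ih =>
    -- Reassembling whole Σ-pairs by one function lets the induction hypotheses be applied without
    -- transport along equalities of shapes.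
    let G : (∀ i : T.Arity σ, Σ t : Term T A, t.Pos → R) → Σ t : Term T A, t.Pos → R := fun x =>
      ⟨.op σ (fun i => (x i).1), fun p => (x p.1).2 p.2⟩
    exact congrArg G (funext fun i => ih i (fun p => f ⟨i, p⟩))

theorem Term.rename_fill {A R R' : Type u} (g : R → R') (t : Term T A) (f : t.Pos → R) :
    (t.fill f).rename (fun p => (p.1, g p.2)) = t.fill (g ∘ f) := by
  induction t with
  | var a => rfl
  | op σ t ih => exact congrArg (Term.op σ) (funext fun i => ih i _)

variable (T T') in
/-- The polynomial functor `R ↦ ∏ τ, T(|τ| × R)`. -/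
def residualFunctor : PFunctor.{u, u} where
  A := ∀ τ : T'.Op, Term T (T'.Arity τ)
  B t := Σ τ, (t τ).Pos

/-- The structure map of a residual comodel as a coalgebra of `residualFunctor`. -/
def ResidualComodel.coalgebra (R : ResidualComodel T T') (r : R.carrier) :
    residualFunctor T T' R.carrier :=
  ⟨fun τ => (R.coop τ r).split.1, fun p => (R.coop p.1 r).split.2 p.2⟩

/-- The co-operations of a coalgebra of `residualFunctor`. -/
def residualFunctor.coop {R : Type u} (x : residualFunctor T T' R) (τ : T'.Op) :
    Term T (T'.Arity τ × R) :=
  (x.1 τ).fill (fun p => x.2 ⟨τ, p⟩)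

theorem residualFunctor.coop_map {R R' : Type u} (g : R → R') (x : residualFunctor T T' R)
    (τ : T'.Op) : coop ((residualFunctor T T').map g x) τ =
      (coop x τ).rename (fun p => (p.1, g p.2)) :=
  (Term.rename_fill g _ _).symm

theorem residualFunctor.coop_injective {R : Type u} {x y : residualFunctor T T' R}
    (h : ∀ τ, coop x τ = coop y τ) : x = y := by
  have key : ∀ z : residualFunctor T T' R,
      z = ⟨fun τ => (coop z τ).split.1, fun p => (coop z p.1).split.2 p.2⟩ := by
    rintro ⟨t, f⟩
    let G : (∀ τ : T'.Op, Σ t : Term T (T'.Arity τ), t.Pos → R) → residualFunctor T T' R :=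
      fun x => ⟨fun τ => (x τ).1, fun p => (x p.1).2 p.2⟩
    exact congrArg G (funext fun τ => (Term.split_fill (t τ) (fun p => f ⟨τ, p⟩)).symm)
  rw [key x, key y, funext h]

variable (T T') in
/-- The final coalgebra of `residualFunctor`, as a residual comodel. -/
def finalResidual : ResidualComodel T T' where
  carrier := (residualFunctor T T').M
  coop τ m := residualFunctor.coop m.dest τ

variable (T T') in
/-- The residual comodel `finalResidual` is final. -/
def finalResidualIsTerminal : IsTerminal (finalResidual T T') :=
  IsTerminal.ofUniqueHom
    (fun R => ResidualComodel.Hom.mk (R := R) (R' := finalResidual T T')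
      (PFunctor.M.corec R.coalgebra) (fun τ r => by
        change _ = residualFunctor.coop (PFunctor.M.dest (PFunctor.M.corec R.coalgebra r)) τ
        rw [PFunctor.M.dest_corec, residualFunctor.coop_map]
        exact congrArg (Term.rename _) (Term.fill_split (R.coop τ r)).symm))
    (fun R m => by
      refine ResidualComodel.hom_ext _ _ (congrFun (PFunctor.M.corec_unique R.coalgebra m.toFun
        fun r => residualFunctor.coop_injective fun τ => ?_))
      refine (m.comm τ r).symm.trans (Eq.trans ?_ (residualFunctor.coop_map m.toFun _ τ).symm)
      exact congrArg (Term.rename _) (Term.fill_split (R.coop τ r)).symm)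

end FinalResidual

end FreeTheory

theorem mainTheorem4 (T T' : FreeTheory.Signature.{u})
    [∀ σ : T.Op, Nonempty (T.Arity σ)] :
    -- the canonical maps `|τ| · Sub(S_T, S_{T'}) ⟶ Sub(S_T, |τ| · S_{T'})` are isomorphisms
    ∃ _ : ∀ τ : T'.Op, IsIso
        ((FreeTheory.finalSub T).comparison (T'.Arity τ) (FreeTheory.finalSub T').obj),
      -- the bimodel `Sub(S_T, S_{T'})` is final
      Nonempty (IsTerminal (FreeTheory.subBimodel T T')) ∧
      -- a final residual comodel exists
      (∃ I : FreeTheory.ResidualComodel T T', Nonempty (IsTerminal I)) ∧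
      ∀ (I : FreeTheory.ResidualComodel T T') (hI : IsTerminal I),
        I.reflect ∘ FreeTheory.reify hI = id ∧ Function.Surjective I.reflect := by
  have hiso : ∀ τ : T'.Op, IsIso
      ((FreeTheory.finalSub T).comparison (T'.Arity τ) (FreeTheory.finalSub T').obj) :=
    fun τ => FreeTheory.isIso_comparison (FreeTheory.finalSub_separated T')
  refine ⟨hiso, ⟨FreeTheory.subBimodelIsTerminal T T'⟩,
    ⟨FreeTheory.finalResidual T T', ⟨FreeTheory.finalResidualIsTerminal T T'⟩⟩, fun I hI => ?_⟩
  -- As `reify` is a map of residual comodels, naturality equates the composite with the extent of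
  -- the final bimodel.
  have h : I.reflect ∘ FreeTheory.reify hI = id :=
    (FreeTheory.ResidualComodel.reflect_naturality
      (hI.from (FreeTheory.subBimodel T T').residual)).symm.trans FreeTheory.reflect_subBimodel
  exact ⟨h, Function.RightInverse.surjective (congrFun h)⟩
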